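/- Let $F$ be a finite field with $q=2^m$ elements, $m\ge 1$, let $\mathrm{Tr}$ be the trace function from $F$ to $\mathbb F_2$, and for $a\in F$ put $$K(a)=\sum_{x\in F\setminus\{0\}}(-1)^{\mathrm{Tr}(ax+1/x)} .$$ Let $b\in F\setminus\{0,1\}$ and let $k$ be a rational number such that $b^{k}$, equivalently $b^{k+1}=b\cdot b^{k}$, is an element of $F$. (Here, for a rational number $r=p/d$ in lowest terms with $d>0$, $b^{r}$ denotes a $d$-th root of $b^{p}$; any such root that lies in $F$ is allowed.) Then $$K\left(\frac{(b^{k+1}+b^2+b)(b^{k+1}+b^2+1)^3}{(1+b)^4}\right)=K\left(\frac{(b^{k+1}+b^2+b)^3(b^{k+1}+b^2+1)}{(1+b)^4}\right).$$ -/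

import Mathlib

/-- The binary Kloosterman sum `K(a) = ∑_{x ∈ F^*} (-1)^{Tr(a x + 1/x)}` over a finite field `F` of
characteristic two, where `Tr` is the trace from `F` to `𝔽₂`. -/
noncomputable def kloostermanSum {F : Type*} [Field F] [Fintype F] [Algebra (ZMod 2) F]
    (a : F) : ℤ :=
  open Classical in
  ∑ x : F with x ≠ 0, (-1 : ℤ) ^ (Algebra.trace (ZMod 2) F (a * x + 1 / x)).val

/-- For `b ≠ 0` and a rational `r = p / d` in lowest terms with `d > 0`: `y` is a value in `F` of
the power `b ^ r`, that is, a `d`-th root of `b ^ p` lying in `F`. If `r` is an integer or, in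
characteristic two, if `d` is a power of two, there is at most one such `y`. -/
def IsRatPow {F : Type*} [Field F] (b : F) (r : ℚ) (y : F) : Prop :=
  y ^ r.den = b ^ r.num

section KloostermanIdentity

variable {F : Type*} [Field F] [Fintype F] [Algebra (ZMod 2) F]

/-! With `a = (t + b² + b) / (1 + b)` the claim becomes `K(a(1+a)³) = K(a³(1+a))`. Substituting `x ↦
x⁻²` gives `K(c) = ∑ (-1)^Tr(x + c/x²)`, which counts points on `y² + xy = x³ + c` or its quadratic
twist. The curves for the two values of `c` are linked by a 3-isogeny whose kernel has
`x`-coordinate `a`. On the twist where `Tr(x + c/x²) ≠ Tr a` the kernel has no rational point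
besides `O`, so the isogeny is bijective on the `x`-coordinates in question (`card_isogenous`). The
fibre over `X` is a cubic in `z = x/(x+a)`, and the trace condition gives it exactly one root
(`exists_cubic_root`, `cubic_root_unique`). -/

theorem two_eq_zero_of_algebra_zmod : (2 : F) = 0 := by
  have h := map_ofNat (algebraMap (ZMod 2) F) 2
  rw [← h, show (OfNat.ofNat 2 : ZMod 2) = 0 from rfl, map_zero]

theorem trace_sq (x : F) : Algebra.trace (ZMod 2) F (x ^ 2) = Algebra.trace (ZMod 2) F x := by
  have h := Algebra.trace_eq_of_algEquiv (FiniteField.frobeniusAlgEquivOfAlgebraic (ZMod 2) F) x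
  simpa [FiniteField.coe_frobeniusAlgEquivOfAlgebraic, ZMod.card] using h

theorem trace_eq_of_eq_add_sq {u v : F} (g : F) (h : u = v + (g + g ^ 2)) :
    Algebra.trace (ZMod 2) F u = Algebra.trace (ZMod 2) F v := by
  rw [h, map_add, map_add, trace_sq, CharTwo.add_self_eq_zero, add_zero]

theorem sq_injective_of_algebra_zmod : Function.Injective fun y : F => y ^ 2 := by
  intro x y h
  have h2 := two_eq_zero_of_algebra_zmod (F := F)
  replace h : x ^ 2 = y ^ 2 := h
  have h' : (x - y) ^ 2 = 0 := by
    linear_combination h + (y ^ 2 - x * y) * h2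
  exact sub_eq_zero.1 (pow_eq_zero_iff two_ne_zero |>.1 h')

theorem exists_sq_eq (x : F) : ∃ y : F, y ^ 2 = x :=
  Finite.surjective_of_injective sq_injective_of_algebra_zmod x

/-- Two distinct roots of `X³ + r²X + c` force the trace of `r / z` to be that of `1`. -/
theorem trace_eq_trace_one_of_cubic_eq {r z w : F} (hz : z ≠ 0) (hne : z ≠ w)
    (h : z ^ 3 + r ^ 2 * z = w ^ 3 + r ^ 2 * w) :
    Algebra.trace (ZMod 2) F (r ^ 2 / z ^ 2) = Algebra.trace (ZMod 2) F 1 := by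
  have h2 := two_eq_zero_of_algebra_zmod (F := F)
  have hq : z ^ 2 + z * w + w ^ 2 + r ^ 2 = 0 := by
    refine mul_left_cancel₀ (sub_ne_zero.2 hne) ?_
    linear_combination h
  refine trace_eq_of_eq_add_sq (w / z) ?_
  field_simp
  linear_combination hq - (z ^ 2 + z * w + w ^ 2) * h2

/-- The two arguments differ by `g + g²` with `g = p/(z² + p)`. Thus the resolvent condition on a
cubic can be tested at any root `z`. -/
theorem trace_cubic_eq {p z : F} (hz : z ≠ 0) (hp : z ^ 2 + p ≠ 0) :
    Algebra.trace (ZMod 2) F (p ^ 3 / (z ^ 3 + p * z) ^ 2) =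
      Algebra.trace (ZMod 2) F (p / z ^ 2) := by
  have h2 := two_eq_zero_of_algebra_zmod (F := F)
  refine trace_eq_of_eq_add_sq (p / (z ^ 2 + p)) ?_
  have e : z ^ 3 + p * z = z * (z ^ 2 + p) := by ring
  rw [e]
  field_simp
  linear_combination (-(p*z^4 + 2 * p^2*z^2)) * h2

/-- In characteristic two, a cubic `X³ + pX + c` with `c ≠ 0` and `Tr (p³/c²) ≠ Tr 1` has a root
in the finite field. -/
theorem exists_cubic_root {p c : F} (hc : c ≠ 0)
    (h : Algebra.trace (ZMod 2) F (p ^ 3 / c ^ 2) ≠ Algebra.trace (ZMod 2) F 1) :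
    ∃ z : F, z ^ 3 + p * z = c := by
  obtain ⟨r, rfl⟩ := exists_sq_eq p
  rcases eq_or_ne r 0 with rfl | hr
  · have hinj : Function.Injective fun y : F => y ^ 3 := by
      intro z w hzw
      by_contra hne
      have hzw' : z ^ 3 = w ^ 3 := hzw
      have hz : z ≠ 0 := by
        rintro rfl
        exact hne (pow_eq_zero_iff three_ne_zero |>.1 (by simpa using hzw'.symm)).symm
      apply h
      have := trace_eq_trace_one_of_cubic_eq (r := 0) hz hne (by simpa using hzw')
      simpa using this
    obtain ⟨z, hz⟩ := Finite.surjective_of_injective hinj c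
    exact ⟨z, by simpa using hz⟩
  -- The map `z ↦ (z³ + r²z)/r²` sends the finite set `A` to itself by `trace_cubic_eq` and is
  -- injective there, hence surjective; the hypothesis says that `c/r²` lies in `A`.
  · let A := {z : F // z ≠ 0 ∧
      Algebra.trace (ZMod 2) F (r ^ 2 / z ^ 2) ≠ Algebra.trace (ZMod 2) F 1}
    have hsq : ∀ z ∈ {z : F | z ≠ 0 ∧
        Algebra.trace (ZMod 2) F (r ^ 2 / z ^ 2) ≠ Algebra.trace (ZMod 2) F 1},
        z ^ 2 + r ^ 2 ≠ 0 := by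
      rintro z ⟨hz, ht⟩ h0
      apply ht
      have h2 := two_eq_zero_of_algebra_zmod (F := F)
      rw [show r ^ 2 = z ^ 2 by linear_combination h0 - z ^ 2 * h2,
        div_self (pow_ne_zero 2 hz)]
    have key : ∀ z : F, r ^ 2 / ((z ^ 3 + r ^ 2 * z) / r ^ 2) ^ 2 =
        (r ^ 2) ^ 3 / (z ^ 3 + r ^ 2 * z) ^ 2 := by
      intro z
      rw [div_pow, div_div_eq_mul_div]
      ring
    let φ : A → A := fun z => ⟨(z.1 ^ 3 + r ^ 2 * z.1) / r ^ 2, by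
      have := hsq z.1 z.2
      refine ⟨div_ne_zero ?_ (pow_ne_zero 2 hr), ?_⟩
      · rw [show z.1 ^ 3 + r ^ 2 * z.1 = z.1 * (z.1 ^ 2 + r ^ 2) by ring]
        exact mul_ne_zero z.2.1 this
      · rw [key, trace_cubic_eq z.2.1 this]
        exact z.2.2⟩
    have hφ : Function.Injective φ := by
      intro z w hzw
      by_contra hne
      refine z.2.2 (trace_eq_trace_one_of_cubic_eq z.2.1 (fun e => hne (Subtype.ext e)) ?_)
      exact (div_left_inj' (pow_ne_zero 2 hr)).1 (congrArg Subtype.val hzw)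
    have hcA : c / r ^ 2 ≠ 0 ∧ Algebra.trace (ZMod 2) F (r ^ 2 / (c / r ^ 2) ^ 2) ≠
        Algebra.trace (ZMod 2) F 1 := by
      refine ⟨div_ne_zero hc (pow_ne_zero 2 hr), ?_⟩
      rw [div_pow, div_div_eq_mul_div, ← pow_succ']
      exact h
    obtain ⟨z, hz⟩ := Finite.surjective_of_injective hφ ⟨c / r ^ 2, hcA⟩
    exact ⟨z.1, (div_left_inj' (pow_ne_zero 2 hr)).1 (congrArg Subtype.val hz)⟩

theorem cubic_root_unique {p z w : F} (hz : z ≠ 0) (hp : z ^ 2 + p ≠ 0)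
    (h : Algebra.trace (ZMod 2) F (p ^ 3 / (z ^ 3 + p * z) ^ 2) ≠ Algebra.trace (ZMod 2) F 1)
    (hzw : z ^ 3 + p * z = w ^ 3 + p * w) : z = w := by
  rw [trace_cubic_eq hz hp] at h
  by_contra hne
  obtain ⟨r, rfl⟩ := exists_sq_eq p
  exact h (trace_eq_trace_one_of_cubic_eq hz hne hzw)

/-- The trace of the resolvent of the cubic `Z³ + (1 + a + X)Z + X`. -/
theorem trace_resolvent (a : F) {X : F} (hX : X ≠ 0) :
    Algebra.trace (ZMod 2) F ((1 + a + X) ^ 3 / X ^ 2) =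
      Algebra.trace (ZMod 2) F (X + a * (1 + a) ^ 3 / X ^ 2 + (1 + a)) := by
  have h2 := two_eq_zero_of_algebra_zmod (F := F)
  have : CharP F 2 := CharTwo.of_one_ne_zero_of_two_eq_zero one_ne_zero h2
  refine trace_eq_of_eq_add_sq ((1 + a) ^ 2 / X) ?_
  field_simp
  grind

/-- Here `az/(1+z)` is `x`, and `(z³ + (1+a)z)/(1+z)` is its image `X` under the isogeny. The right
side is `Tr(p/z²)` for the coefficient `p = 1 + a + X` of the fibre cubic, ready for
`trace_cubic_eq`. -/
theorem trace_residual {a z : F} (hz : z ≠ 0) (hz1 : 1 + z ≠ 0) :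
    Algebra.trace (ZMod 2) F
        (a * z / (1 + z) + a ^ 3 * (1 + a) / (a * z / (1 + z)) ^ 2 + (1 + a)) =
      Algebra.trace (ZMod 2) F ((1 + a + (z ^ 3 + (1 + a) * z) / (1 + z)) / z ^ 2) := by
  have h2 := two_eq_zero_of_algebra_zmod (F := F)
  have : CharP F 2 := CharTwo.of_one_ne_zero_of_two_eq_zero one_ne_zero h2
  rcases eq_or_ne a 0 with rfl | ha
  · refine trace_eq_of_eq_add_sq (1 / z) ?_
    field_simp
    grind
  refine trace_eq_of_eq_add_sq (a + a / z + 1 / z) ?_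
  field_simp
  grind

/-- Each sign is `(-1)^Tr a`, flipped exactly when the trace differs from `Tr a`; so only the size
of the differing class depends on `c`. -/
theorem kloostermanSum_eq_card (a c : F) :
    open Classical in
    kloostermanSum c = (-1) ^ (Algebra.trace (ZMod 2) F a).val *
      ((Finset.univ.filter fun x : F => x ≠ 0).card - 2 * (Finset.univ.filter fun x : F => x ≠ 0 ∧
        Algebra.trace (ZMod 2) F (x + c / x ^ 2) ≠ Algebra.trace (ZMod 2) F a).card : ℤ) := by
  classical
  have hsum : kloostermanSum c = ∑ x : F with x ≠ 0,
      (-1 : ℤ) ^ (Algebra.trace (ZMod 2) F (x + c / x ^ 2)).val := by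
    unfold kloostermanSum
    symm
    refine Finset.sum_bij (fun x _ => (x ^ 2)⁻¹) ?_ ?_ ?_ ?_
    · intro x hx
      simpa using hx
    · intro x _ y _ h
      exact sq_injective_of_algebra_zmod (inv_injective h)
    · intro y hy
      obtain ⟨x, hx⟩ := exists_sq_eq y⁻¹
      refine ⟨x, ?_, by rw [hx, inv_inv]⟩
      simp only [Finset.mem_filter, Finset.mem_univ, true_and] at hy ⊢
      rintro rfl
      exact inv_ne_zero hy (by simpa using hx.symm)
    · intro x _
      rw [one_div, inv_inv, ← div_eq_mul_inv, map_add, map_add, trace_sq, add_comm]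
  have hval : ∀ u e : ZMod 2, (-1 : ℤ) ^ u.val =
      (-1) ^ e.val * (1 - 2 * if u ≠ e then 1 else 0) := by decide
  rw [hsum, Finset.sum_congr rfl fun x _ => hval _ (Algebra.trace (ZMod 2) F a),
    ← Finset.mul_sum, Finset.sum_sub_distrib, ← Finset.mul_sum, Finset.sum_boole,
    Finset.filter_filter]
  simp

/-- The `x`-coordinate of the 3-isogeny with kernel `{O, ±P}`, `x(P) = a`, from
`y² + xy = x³ + a³(1 + a)`, in terms of `z = x / (x + a)`. -/
theorem isogeny_trace {a z X : F} (hz : z ≠ 0) (hz1 : 1 + z ≠ 0) (hX : X ≠ 0)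
    (h : z ^ 3 + (1 + a + X) * z = X) :
    Algebra.trace (ZMod 2) F (a * z / (1 + z) + a ^ 3 * (1 + a) / (a * z / (1 + z)) ^ 2) =
      Algebra.trace (ZMod 2) F (X + a * (1 + a) ^ 3 / X ^ 2) := by
  have h2 := two_eq_zero_of_algebra_zmod (F := F)
  have hX' : (z ^ 3 + (1 + a) * z) / (1 + z) = X := by
    rw [div_eq_iff hz1]
    linear_combination h - X * z * h2
  have hp : z ^ 2 + (1 + a + X) ≠ 0 := by
    intro h0
    exact hX (by linear_combination z * h0 - h)
  have h1 := trace_residual (a := a) hz hz1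
  have h3 := trace_resolvent a hX
  have h4 := trace_cubic_eq hz hp
  rw [h] at h4
  rw [hX', ← h4, h3, map_add, map_add _ (X + _)] at h1
  exact add_right_cancel h1

theorem card_isogenous (a : F) (ha : a ≠ 0) :
    open Classical in
    (Finset.univ.filter fun x : F => x ≠ 0 ∧
      Algebra.trace (ZMod 2) F (x + a ^ 3 * (1 + a) / x ^ 2) ≠ Algebra.trace (ZMod 2) F a).card =
    (Finset.univ.filter fun x : F => x ≠ 0 ∧
      Algebra.trace (ZMod 2) F (x + a * (1 + a) ^ 3 / x ^ 2) ≠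
        Algebra.trace (ZMod 2) F a).card := by
  classical
  have h2 := two_eq_zero_of_algebra_zmod (F := F)
  have htwo : (2 : ZMod 2) = 0 := rfl
  have hres : ∀ X : F, X ≠ 0 → Algebra.trace (ZMod 2) F (X + a * (1 + a) ^ 3 / X ^ 2) ≠
      Algebra.trace (ZMod 2) F a →
      Algebra.trace (ZMod 2) F ((1 + a + X) ^ 3 / X ^ 2) ≠ Algebra.trace (ZMod 2) F 1 := by
    intro X hX h h'
    rw [trace_resolvent a hX, map_add, map_add _ 1 a] at h'
    apply h
    linear_combination h' - Algebra.trace (ZMod 2) F a * htwo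
  have hroot : ∀ z X : F, X ≠ 0 → z ^ 3 + (1 + a + X) * z = X → z ≠ 0 ∧ 1 + z ≠ 0 := by
    intro z X hX h
    refine ⟨?_, fun h1 => ha ?_⟩
    · rintro rfl
      exact hX (by simpa using h.symm)
    · have : z = 1 := by linear_combination h1 - h2
      subst this
      linear_combination h - h2
  symm
  have hex : ∀ X ∈ Finset.univ.filter fun x : F => x ≠ 0 ∧
      Algebra.trace (ZMod 2) F (x + a * (1 + a) ^ 3 / x ^ 2) ≠ Algebra.trace (ZMod 2) F a,
      ∃ z : F, z ^ 3 + (1 + a + X) * z = X := by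
    intro X hX
    simp only [Finset.mem_filter, Finset.mem_univ, true_and] at hX
    exact exists_cubic_root hX.1 (hres X hX.1 hX.2)
  choose! ζ hζ using hex
  -- This is `z = x/(x+a)` solved for `x` at the root `z = ζ X`, so the bijection is the inverse of
  -- the isogeny on `x`-coordinates.
  refine Finset.card_bij (fun X _ => a * ζ X / (1 + ζ X)) ?_ ?_ ?_
  · intro X hX
    have h := hζ X hX
    simp only [Finset.mem_filter, Finset.mem_univ, true_and] at hX ⊢
    obtain ⟨hz, hz1⟩ := hroot _ _ hX.1 h
    refine ⟨div_ne_zero (mul_ne_zero ha hz) hz1, ?_⟩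
    rw [isogeny_trace hz hz1 hX.1 h]
    exact hX.2
  · intro X hX Y hY hXY
    have h := hζ X hX
    have h' := hζ Y hY
    simp only [Finset.mem_filter, Finset.mem_univ, true_and] at hX hY
    obtain ⟨_, hz1⟩ := hroot _ _ hX.1 h
    obtain ⟨_, hw1⟩ := hroot _ _ hY.1 h'
    have e : ζ X = ζ Y := by
      rw [div_eq_div_iff hz1 hw1] at hXY
      exact mul_left_cancel₀ ha (by linear_combination hXY)
    rw [← e] at h'
    exact mul_left_cancel₀ hz1 (by linear_combination h' - h + (X - Y) * ζ X * h2)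
  · intro x hx
    simp only [Finset.mem_filter, Finset.mem_univ, true_and] at hx
    obtain ⟨hx0, hx⟩ := hx
    -- The kernel coordinate is excluded: at `x = a` the argument of the trace is `a²`, with trace
    -- `Tr a`.
    have hxa : x + a ≠ 0 := by
      intro h0
      have : x = a := by linear_combination h0 - a * h2
      subst this
      apply hx
      rw [← trace_sq x]
      congr 1
      field_simp
      linear_combination h2
    obtain ⟨z, hzdef⟩ : ∃ z, z = x / (x + a) := ⟨_, rfl⟩
    have hz : z ≠ 0 := hzdef ▸ div_ne_zero hx0 hxa
    have hz1' : 1 + z = a / (x + a) := by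
      rw [hzdef]
      field_simp
      linear_combination x * h2
    have hz1 : 1 + z ≠ 0 := hz1' ▸ div_ne_zero ha hxa
    have hxz : a * z / (1 + z) = x := by
      rw [hz1', hzdef]
      field_simp
    obtain ⟨X, hXdef⟩ : ∃ X, X = (z ^ 3 + (1 + a) * z) / (1 + z) := ⟨_, rfl⟩
    have hXz : z ^ 3 + (1 + a + X) * z = X := by
      rw [eq_div_iff hz1] at hXdef
      linear_combination -hXdef + X * z * h2
    -- If `X = 0` then `z² = 1 + a`, and `trace_residual` makes the trace at `x` equal to `Tr a`.
    have hX : X ≠ 0 := by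
      intro h0
      have h1 := trace_residual (a := a) hz hz1
      rw [← hXdef, hxz, h0] at h1
      have h3 : (1 + a + 0) / z ^ 2 = 1 := by
        rw [div_eq_one_iff_eq (pow_ne_zero 2 hz)]
        refine mul_left_cancel₀ hz ?_
        rw [h0] at hXz
        linear_combination hXz - z ^ 3 * h2
      rw [h3, map_add, map_add _ 1 a] at h1
      apply hx
      linear_combination h1 - Algebra.trace (ZMod 2) F a * htwo
    have hXt : Algebra.trace (ZMod 2) F (X + a * (1 + a) ^ 3 / X ^ 2) ≠
        Algebra.trace (ZMod 2) F a := by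
      rw [← isogeny_trace hz hz1 hX hXz, hxz]
      exact hx
    have hXmem : X ∈ Finset.univ.filter fun x : F => x ≠ 0 ∧
        Algebra.trace (ZMod 2) F (x + a * (1 + a) ^ 3 / x ^ 2) ≠ Algebra.trace (ZMod 2) F a := by
      simpa only [Finset.mem_filter, Finset.mem_univ, true_and] using ⟨hX, hXt⟩
    refine ⟨X, hXmem, ?_⟩
    have hp : z ^ 2 + (1 + a + X) ≠ 0 := fun h0 => hX (by linear_combination z * h0 - hXz)
    have e : z = ζ X := by
      refine cubic_root_unique hz hp ?_ (hXz.trans (hζ X hXmem).symm)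
      rw [hXz]
      exact hres X hX hXt
    rw [← e, hxz]

/-- The Kloosterman sum identity `K(a³(1 + a)) = K(a(1 + a)³)`. -/
theorem kloostermanSum_cube_mul (a : F) :
    kloostermanSum (a ^ 3 * (1 + a)) = kloostermanSum (a * (1 + a) ^ 3) := by
  rcases eq_or_ne a 0 with rfl | ha
  · simp
  · rw [kloostermanSum_eq_card a, kloostermanSum_eq_card a, card_isogenous a ha]

end KloostermanIdentity

theorem corollary4 {F : Type*} [Field F] [Fintype F] [Algebra (ZMod 2) F]
    (b : F) (hb0 : b ≠ 0) (hb1 : b ≠ 1)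
    (k : ℚ) (t : F) (ht : IsRatPow b (k + 1) t) :
    kloostermanSum ((t + b ^ 2 + b) * (t + b ^ 2 + 1) ^ 3 / (1 + b) ^ 4) =
      kloostermanSum ((t + b ^ 2 + b) ^ 3 * (t + b ^ 2 + 1) / (1 + b) ^ 4) := by
  have h2 := two_eq_zero_of_algebra_zmod (F := F)
  have hb : 1 + b ≠ 0 := fun h => hb1 (by linear_combination h - h2)
  -- The two numerators add up to `1 + b` in characteristic two, so the quotients are `a` and `1 +
  -- a`.
  have e : 1 + (t + b ^ 2 + b) / (1 + b) = (t + b ^ 2 + 1) / (1 + b) := by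
    field_simp
    linear_combination b * h2
  have h := kloostermanSum_cube_mul ((t + b ^ 2 + b) / (1 + b))
  rw [e] at h
  convert h.symm using 2
  · field_simp
  · field_simp
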